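/- **Setting.** For $\ell>0$ and $0<\alpha<\theta<\pi/2$ let $b(x)=\ell+(\tfrac12-|x|)\tan\alpha$ for $x\in[-\tfrac12,\tfrac12]$, and let $\{(x,y): |x|\le \tfrac12,\ |y|\le b(x)\}$ be the unfolding of the rectangular trapezoid with height $\tfrac12$, shorter base $\ell$ and slope angle $\alpha$. Identify its left and right sides, and identify $(x,b(x))$ with $(x,-b(x))$. The linear flow in direction $\theta$ moves points with constant velocity $(\cos\theta,\sin\theta)$, continuing from the identified boundary point with the same velocity. Its first-return map to the section $\{y=0\}$, viewed as a map of the circle $\mathbb T=\mathbb R/\mathbb Z$, is denoted $f_{\ell,\alpha,\theta}$ and called a trapezoid return map. A lift of a circle map $f$ is a homeomorphism $F:\mathbb R\to\mathbb R$ with $F(x+1)=F(x)+1$ which induces $f$ on $\mathbb R/\mathbb Z$. Let $u_1<u_2$ and let $(f_u)_{u\in[u_1,u_2]}$ be a family of trapezoid return maps that is continuous and strictly increasing, meaning that there are lifts $F_u$ of $f_u$ such that $u\mapsto F_u$ is continuous in the sup norm on $\mathbb R$ and, for every $x\in\mathbb R$, $u\mapsto F_u(x)$ is strictly increasing. Put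 $\rho(u)=\lim_{n\to\infty}\frac{F_u^n(x)-x}{n}\in\mathbb R$ (the limit exists and does not depend on $x$). Let $Q_o$ be the set of rationals $p/q$ with $p,q$ coprime and $q$ odd (so $0=0/1\in Q_o$). **Proposition.** Let $r\in[\rho(u_1),\rho(u_2)]$. (i) If $r\in Q_o$, then $\rho^{-1}(r)$ is a non-empty closed interval, which is non-degenerate if $\rho(u_1)<r<\rho(u_2)$; and for no $u\in\rho^{-1}(r)$ is $f_u$ topologically conjugate (via a homeomorphism of $\mathbb T$) to a rotation. (ii) If $r\notin Q_o$, then $\rho^{-1}(r)$ consists of a single point $u_r$, and $f_{u_r}$ is topologically conjugate to the rotation $x\mapsto x+r \pmod 1$. -/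

import Mathlib

open Set Filter Topology

noncomputable section

/-- Upper boundary of the unfolded trapezoid. The trapezoid has height `1/2`, shorter base `ℓ` and
slope angle `α`; its unfolding is the region `|y| ≤ roof ℓ α x`, where `x` ranges over `[-1/2, 1/2]`
with the two ends (left and right sides) identified, and `‖x‖ = |x|` for `x ∈ [-1/2, 1/2]`. -/
def roof (ℓ α : ℝ) (x : UnitAddCircle) : ℝ :=
  ℓ + (1 / 2 - ‖x‖) * Real.tan α

/-- Time of the first collision with the upper boundary, for the unit-speed motion that leaves the
point `(x, 0)` of the horizontal section `Σ` in the direction `(cos θ, sin θ)`. -/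
def collisionTime (ℓ α θ : ℝ) (x : UnitAddCircle) : ℝ :=
  sInf {s : ℝ | 0 < s ∧ s * Real.sin θ = roof ℓ α (x + ((s * Real.cos θ : ℝ) : UnitAddCircle))}

/-- Abscissa of the first collision point with the upper boundary. -/
def collisionPoint (ℓ α θ : ℝ) (x : UnitAddCircle) : UnitAddCircle :=
  x + ((collisionTime ℓ α θ x * Real.cos θ : ℝ) : UnitAddCircle)

/-- First-return map to the section `Σ` of the linear flow in direction `θ` on the unfolded
trapezoid. After the collision at abscissa `c`, the motion continues from the opposite point
`(c, -roof c)` of the lower boundary with the same velocity, and therefore reaches the section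
`y = 0` again after the further time `roof c / sin θ`. -/
def trapezoidReturnMap (ℓ α θ : ℝ) (x : UnitAddCircle) : UnitAddCircle :=
  collisionPoint ℓ α θ x +
    ((roof ℓ α (collisionPoint ℓ α θ x) / Real.sin θ * Real.cos θ : ℝ) : UnitAddCircle)

/-- The circle maps of the type `f_{ℓ, α, θ}`. -/
def IsTrapezoidReturnMap (f : UnitAddCircle → UnitAddCircle) : Prop :=
  ∃ ℓ α θ : ℝ, 0 < ℓ ∧ 0 < α ∧ α < θ ∧ θ < Real.pi / 2 ∧ f = trapezoidReturnMap ℓ α θ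

/-- `F` is a lift of the circle map `f`: a homeomorphism of `ℝ` which commutes with integer
translations (part of `CircleDeg1Lift`) and acts as `f` on classes modulo `1`. -/
def IsCircleLift (F : CircleDeg1Lift) (f : UnitAddCircle → UnitAddCircle) : Prop :=
  IsHomeomorph (F : ℝ → ℝ) ∧ ∀ x : ℝ, ((F x : ℝ) : UnitAddCircle) = f (x : UnitAddCircle)

/-- The lifts `F u` exhibit `(f u)`, `u ∈ [u₁, u₂]`, as a continuous strictly increasing family. -/
structure IsContinuousStrictlyIncreasingFamily (u₁ u₂ : ℝ)
    (f : ℝ → UnitAddCircle → UnitAddCircle) (F : ℝ → CircleDeg1Lift) : Prop where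
  lift : ∀ u ∈ Icc u₁ u₂, IsCircleLift (F u) (f u)
  continuous_supNorm : ∀ v ∈ Icc u₁ u₂,
    TendstoUniformly (fun (u : ℝ) (x : ℝ) => F u x) (fun x : ℝ => F v x) (𝓝[Icc u₁ u₂] v)
  strictMono : ∀ x : ℝ, StrictMonoOn (fun u : ℝ => F u x) (Icc u₁ u₂)

/-- `f` is topologically conjugate to the rotation `x ↦ x + s` of the circle. -/
def IsConjugateToRotation (f : UnitAddCircle → UnitAddCircle) (s : UnitAddCircle) : Prop :=
  ∃ h : UnitAddCircle ≃ₜ UnitAddCircle, ∀ x, h (f x) = h x + s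

/-- The rationals, as real numbers, of the form `p / q` with `p`, `q` coprime and `q` odd. -/
def oddDenomRationals : Set ℝ :=
  {r | ∃ (p : ℤ) (q : ℕ), 0 < q ∧ IsCoprime p (q : ℤ) ∧ Odd q ∧ r = (p : ℝ) / (q : ℝ)}

/-- The fibre `ρ⁻¹(r)` in `[u₁, u₂]`, where `ρ(u) = lim (F_u^n(x) - x) / n ∈ ℝ` is the rotation
number of the lift `F u` (Mathlib's `translationNumber`). -/
def rotationFibre (u₁ u₂ : ℝ) (F : ℝ → CircleDeg1Lift) (r : ℝ) : Set ℝ :=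
  {u | u ∈ Icc u₁ u₂ ∧ (F u).translationNumber = r}

end

/-! Parametrised by the collision abscissa, a lift of a trapezoid return map is piecewise linear
with two slopes `κ < 1` and `κ⁻¹`. The slope of the `n`-th iterate is therefore `κ ^ e` with `e ≡ n`
mod 2, and this parity separates the two cases.

If `q` is odd, `F^q` never has slope 1, so `F^q` is not a translation. This rules out conjugacy to a
rotation, and it also gives the plateau: a one-point fibre over an interior value `p / q` would
force `F^q = id + p`.

Otherwise `F` is conjugate to a translation (`HasTwoSlopes.exists_conj_translate`), and there the
rotation number increases strictly with the parameter. The tool is a Denjoy–Koksma bound: along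
segments whose first `q` images are disjoint mod 1, the exponent varies by at most 2, because only
the two breakpoints `a`, `b` contribute. For even `q` the exponent is even, so it cannot change sign
between neighbouring periodic points; hence `F^q - id - p`, zero at both ends, vanishes throughout.
For irrational rotation number the same bound, at times of best approximation, excludes wandering
intervals as in Denjoy's theorem. -/

/-! ### Slope exponents and the Denjoy–Koksma bound -/

/-- Counts, with sign, the points of `a + ℤ` and `b + ℤ` below `x`: for `a < b < a + 1` it equals `1`
on `[a, b) + ℤ` and `-1` elsewhere. -/
noncomputable def slopeExponent (a b x : ℝ) : ℤ := 2 * (⌊x - a⌋ - ⌊x - b⌋) - 1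

/-- The exponent of the right derivative of the `n`-th iterate, see
`HasTwoSlopes.hasDerivWithinAt_iterate`. -/
noncomputable def iterateExponent (F : ℝ → ℝ) (a b : ℝ) (n : ℕ) (x : ℝ) : ℤ :=
  ∑ i ∈ Finset.range n, slopeExponent a b (F^[i] x)

/-- A piecewise linear lift with slopes `κ` and `κ⁻¹`, which change on `a + ℤ` and `b + ℤ`. -/
structure HasTwoSlopes (F : CircleDeg1Lift) (κ a b : ℝ) : Prop where
  bijective : Function.Bijective F
  pos : 0 < κ
  lt_one : κ < 1
  deriv_right : ∀ x, HasDerivWithinAt F (κ ^ slopeExponent a b x) (Ici x) x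

theorem iterateExponent_eq (F : ℝ → ℝ) (a b : ℝ) (n : ℕ) (x : ℝ) :
    iterateExponent F a b n x
      = 2 * (∑ i ∈ Finset.range n, (⌊F^[i] x - a⌋ - ⌊F^[i] x - b⌋)) - n := by
  rw [iterateExponent, Finset.mul_sum]
  simp [slopeExponent]

theorem iterateExponent_even {F : ℝ → ℝ} {a b : ℝ} {n : ℕ} (hn : Even n) (x : ℝ) :
    Even (iterateExponent F a b n x) := by
  rw [iterateExponent_eq]
  exact (even_two_mul _).sub (by exact_mod_cast hn)

theorem iterateExponent_odd {F : ℝ → ℝ} {a b : ℝ} {n : ℕ} (hn : Odd n) (x : ℝ) :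
    Odd (iterateExponent F a b n x) := by
  rw [iterateExponent_eq]
  exact (even_two_mul _).sub_odd (by exact_mod_cast hn)

/-- Pairwise disjoint (modulo `1`) intervals contain at most one point of `a + ℤ`. -/
theorem sum_floor_sub_floor_mem {n : ℕ} {y z : ℕ → ℝ} (hyz : ∀ i, y i ≤ z i)
    (hdisj : ∀ i < n, ∀ k < n, ∀ m : ℤ, ∀ w, y i < w → w ≤ z i → y k + m < w → w ≤ z k + m →
      i = k ∧ m = 0) (a : ℝ) :
    0 ≤ ∑ i ∈ Finset.range n, (⌊z i - a⌋ - ⌊y i - a⌋) ∧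
      ∑ i ∈ Finset.range n, (⌊z i - a⌋ - ⌊y i - a⌋) ≤ 1 := by
  have hnonneg : ∀ i, 0 ≤ ⌊z i - a⌋ - ⌊y i - a⌋ := fun i ↦
    sub_nonneg.2 (Int.floor_mono (by linarith [hyz i]))
  have hmem : ∀ i, ∀ m : ℤ, ⌊y i - a⌋ < m → m ≤ ⌊z i - a⌋ → y i - m < a ∧ a ≤ z i - m := by
    intro i m h1 h2
    rw [Int.floor_lt] at h1
    rw [Int.le_floor] at h2
    constructor <;> linarith
  have huniq : ∀ i < n, ∀ k < n, ∀ m m' : ℤ, ⌊y i - a⌋ < m → m ≤ ⌊z i - a⌋ → ⌊y k - a⌋ < m' →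
      m' ≤ ⌊z k - a⌋ → i = k ∧ m = m' := by
    intro i hi k hk m m' h1 h2 h3 h4
    obtain ⟨h5, h6⟩ := hmem i m h1 h2
    obtain ⟨h7, h8⟩ := hmem k m' h3 h4
    obtain ⟨h, h'⟩ := hdisj i hi k hk (m - m') (a + m) (by linarith) (by linarith)
      (by push_cast; linarith) (by push_cast; linarith)
    exact ⟨h, by linarith⟩
  refine ⟨Finset.sum_nonneg fun i _ ↦ hnonneg i, ?_⟩
  by_cases h : ∃ i < n, ⌊y i - a⌋ < ⌊z i - a⌋
  · obtain ⟨i, hi, hlt⟩ := h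
    rw [Finset.sum_eq_single_of_mem i (Finset.mem_range.2 hi)]
    · by_contra! h2
      have := (huniq i hi i hi ⌊z i - a⌋ (⌊z i - a⌋ - 1) hlt le_rfl (by linarith) (by linarith)).2
      linarith
    · intro k hk hki
      by_contra hne
      have hlt' : ⌊y k - a⌋ < ⌊z k - a⌋ := by
        have := hnonneg k
        omega
      exact hki (huniq k (Finset.mem_range.1 hk) i hi _ _ hlt' le_rfl hlt le_rfl).1
  · push Not at h
    exact (Finset.sum_nonpos fun i hi ↦ sub_nonpos.2 (h i (Finset.mem_range.1 hi))).trans zero_le_one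

/-- A Denjoy–Koksma inequality for the slope exponents. -/
theorem abs_iterateExponent_sub_le {F : ℝ → ℝ} (hF : Monotone F) {n : ℕ} {y z : ℝ} (hyz : y ≤ z)
    (hdisj : ∀ i < n, ∀ k < n, ∀ m : ℤ, ∀ w, F^[i] y < w → w ≤ F^[i] z → F^[k] y + m < w →
      w ≤ F^[k] z + m → i = k ∧ m = 0) (a b : ℝ) :
    |iterateExponent F a b n z - iterateExponent F a b n y| ≤ 2 := by
  have hle : ∀ i, F^[i] y ≤ F^[i] z := fun i ↦ hF.iterate i hyz
  have ha := sum_floor_sub_floor_mem hle hdisj a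
  have hb := sum_floor_sub_floor_mem hle hdisj b
  have h : iterateExponent F a b n z - iterateExponent F a b n y
      = 2 * (∑ i ∈ Finset.range n, (⌊F^[i] z - a⌋ - ⌊F^[i] y - a⌋)
        - ∑ i ∈ Finset.range n, (⌊F^[i] z - b⌋ - ⌊F^[i] y - b⌋)) := by
    rw [iterateExponent, iterateExponent, ← Finset.sum_sub_distrib, ← Finset.sum_sub_distrib,
      Finset.mul_sum]
    refine Finset.sum_congr rfl fun i _ ↦ ?_
    simp only [slopeExponent]
    ring
  -- Each of the two sums lies between 0 and 1, one for each breakpoint class; the constants `-1` in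
  -- the exponents have cancelled.
  rw [h, abs_le]
  constructor <;> linarith [ha.1, ha.2, hb.1, hb.2]

/-! ### Iterates of two-slope lifts -/

namespace HasTwoSlopes

variable {F : CircleDeg1Lift} {κ a b : ℝ}

theorem continuous (h : HasTwoSlopes F κ a b) : Continuous F :=
  F.continuous_iff_surjective.2 h.bijective.2

theorem strictMono (h : HasTwoSlopes F κ a b) : StrictMono F :=
  F.strictMono_iff_injective.2 h.bijective.1

/-- Right derivatives exist even at breakpoints and compose because `F` is increasing; the mean
value inequalities below need no more, so no exceptional set appears. -/
theorem hasDerivWithinAt_iterate (h : HasTwoSlopes F κ a b) (n : ℕ) (x : ℝ) :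
    HasDerivWithinAt F^[n] (κ ^ iterateExponent F a b n x) (Ici x) x := by
  induction n with
  | zero => simpa [iterateExponent] using hasDerivWithinAt_id x (Ici x)
  | succ n ih =>
    rw [Function.iterate_succ']
    have := (h.deriv_right (F^[n] x)).comp x ih fun y hy ↦ F.monotone.iterate n hy
    rwa [← zpow_add₀ h.pos.ne', add_comm, iterateExponent, ← Finset.sum_range_succ
      (fun i ↦ slopeExponent a b (F^[i] x)) n] at this

theorem iterate_sub_le (h : HasTwoSlopes F κ a b) {n : ℕ} {y z C : ℝ} (hyz : y ≤ z)
    (hC : ∀ w ∈ Ico y z, κ ^ iterateExponent F a b n w ≤ C) :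
    F^[n] z - F^[n] y ≤ C * (z - y) := by
  have := image_le_of_deriv_right_le_deriv_boundary (f := F^[n])
    (f' := fun w ↦ κ ^ iterateExponent F a b n w) (a := y) (b := z)
    (B := fun w ↦ F^[n] y + C * (w - y)) (B' := fun _ ↦ C)
    (h.continuous.iterate n).continuousOn (fun x _ ↦ h.hasDerivWithinAt_iterate n x)
    (by simp) (by fun_prop)
    (fun x _ ↦ by
      simpa using ((((hasDerivAt_id x).sub_const y).const_mul C).const_add
        (F^[n] y)).hasDerivWithinAt) hC (right_mem_Icc.2 hyz)
  linarith

theorem le_iterate_sub (h : HasTwoSlopes F κ a b) {n : ℕ} {y z C : ℝ} (hyz : y ≤ z)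
    (hC : ∀ w ∈ Ico y z, C ≤ κ ^ iterateExponent F a b n w) :
    C * (z - y) ≤ F^[n] z - F^[n] y := by
  have := image_le_of_deriv_right_le_deriv_boundary (f := fun w ↦ F^[n] y + C * (w - y))
    (f' := fun _ ↦ C) (a := y) (b := z)
    (B := F^[n]) (B' := fun w ↦ κ ^ iterateExponent F a b n w) (by fun_prop)
    (fun x _ ↦ by
      simpa using ((((hasDerivAt_id x).sub_const y).const_mul C).const_add
        (F^[n] y)).hasDerivWithinAt)
    (by simp) (h.continuous.iterate n).continuousOn (fun x _ ↦ h.hasDerivWithinAt_iterate n x)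
     hC (right_mem_Icc.2 hyz)
  linarith

/-- An odd iterate has no point with slope `1`, hence is not a translation. -/
theorem exists_iterate_ne_add (h : HasTwoSlopes F κ a b) {n : ℕ} (hn : Odd n) (c : ℝ) :
    ∃ x, F^[n] x ≠ x + c := by
  by_contra! H
  have h1 := h.hasDerivWithinAt_iterate n 0
  rw [funext H] at h1
  have h2 : HasDerivWithinAt (fun x : ℝ ↦ x + c) 1 (Ici 0) 0 :=
    ((hasDerivAt_id (0 : ℝ)).add_const c).hasDerivWithinAt
  have h3 := (uniqueDiffWithinAt_Ici (0 : ℝ)).eq_deriv _ h1 h2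
  rw [zpow_eq_one_iff_right₀ h.pos.le h.lt_one.ne] at h3
  have := iterateExponent_odd (F := F) (a := a) (b := b) hn 0
  rw [h3] at this
  simp at this

end HasTwoSlopes

/-! ### Rational rotation number with even denominator -/

theorem CircleDeg1Lift.iterate_add_int (F : CircleDeg1Lift) (n : ℕ) (x : ℝ) (m : ℤ) :
    F^[n] (x + m) = F^[n] x + m := by
  rw [← CircleDeg1Lift.coe_pow, CircleDeg1Lift.map_add_int]

/-- For a reduced fraction `p / q`, the first `q` iterates of a point are distinct modulo `1`. -/
theorem CircleDeg1Lift.iterate_ne_iterate_add_int {F : CircleDeg1Lift} {p : ℤ} {q : ℕ}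
    (hpq : IsCoprime p (q : ℤ)) (hτ : F.translationNumber = p / q) {i k : ℕ} (hki : k < i)
    (hiq : i < q) (x : ℝ) (m : ℤ) : F^[i] x ≠ F^[k] x + m := by
  intro h
  obtain ⟨d, rfl⟩ := Nat.exists_eq_add_of_lt hki
  have h1 : (F ^ (d + 1)) (F^[k] x) = F^[k] x + m := by
    rw [CircleDeg1Lift.coe_pow, ← Function.iterate_add_apply, ← h,
      show d + 1 + k = k + d + 1 by ring]
  -- A coincidence makes the rotation number `m / (d + 1)`, so `q` divides `d + 1 < q`.
  have h2 := F.translationNumber_of_map_pow_eq_add_int h1 d.succ_pos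
  have hq : (0 : ℝ) < q := by
    have : 0 < q := by omega
    exact_mod_cast this
  rw [hτ, div_eq_div_iff hq.ne' (by positivity)] at h2
  have h3 : p * ((d + 1 : ℕ) : ℤ) = m * q := by exact_mod_cast h2
  have h4 : (q : ℤ) ∣ ((d + 1 : ℕ) : ℤ) := hpq.symm.dvd_of_dvd_mul_left ⟨m, by rw [h3, mul_comm]⟩
  have := Nat.le_of_dvd d.succ_pos (by exact_mod_cast h4)
  omega

namespace HasTwoSlopes

variable {F : CircleDeg1Lift} {κ a b : ℝ}

/-- Let `x ≤ y ≤ x'` be the nearest points of `Z` around `y`. The first `q` images of the gap `[x,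
x')` are disjoint mod 1, so the exponent of `F^q` varies by at most 2 on it. Being even, it has
constant weak sign, and `F^q - id` is monotone there with equal values `p` at the two ends. -/
theorem iterate_eq_add_of_even (h : HasTwoSlopes F κ a b) {p : ℤ} {q : ℕ} (hq : 0 < q)
    (hqe : Even q) (hpq : IsCoprime p (q : ℤ)) (hτ : F.translationNumber = p / q) (y : ℝ) :
    F^[q] y = y + p := by
  by_contra hy
  obtain ⟨x₀, hx₀⟩ := (F.translationNumber_eq_rat_iff h.continuous hq).1 hτ
  rw [CircleDeg1Lift.coe_pow] at hx₀
  set Z : Set ℝ := {x | F^[q] x = x + p} with hZ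
  have hZclosed : IsClosed Z :=
    isClosed_eq (h.continuous.iterate q) (continuous_id.add continuous_const)
  have hZint : ∀ x ∈ Z, ∀ m : ℤ, x + m ∈ Z := by
    intro x hx m
    simp only [hZ, mem_ofPred_eq] at hx ⊢
    rw [F.iterate_add_int, hx]
    ring
  have hZit : ∀ x, ∀ i, F^[i] x ∈ Z ↔ x ∈ Z := by
    intro x i
    simp only [hZ, mem_ofPred_eq]
    rw [← Function.iterate_add_apply, add_comm, Function.iterate_add_apply, ← F.iterate_add_int]
    exact (h.bijective.1.iterate i).eq_iff
  have hlow : (Z ∩ Iic y).Nonempty := by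
    refine ⟨x₀ + ⌊y - x₀⌋, hZint _ hx₀ _, ?_⟩
    have := Int.floor_le (y - x₀)
    simp only [mem_Iic]
    linarith
  have hupp : (Z ∩ Ici y).Nonempty := by
    refine ⟨x₀ + ⌈y - x₀⌉, hZint _ hx₀ _, ?_⟩
    have := Int.le_ceil (y - x₀)
    simp only [mem_Ici]
    linarith
  have hbl : BddAbove (Z ∩ Iic y) := bddAbove_Iic.mono inter_subset_right
  have hbu : BddBelow (Z ∩ Ici y) := bddBelow_Ici.mono inter_subset_right
  obtain ⟨hx, hxy⟩ := (hZclosed.inter isClosed_Iic).csSup_mem hlow hbl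
  obtain ⟨hx', hyx'⟩ := (hZclosed.inter isClosed_Ici).csInf_mem hupp hbu
  set x := sSup (Z ∩ Iic y)
  set x' := sInf (Z ∩ Ici y)
  have hgap₀ : ∀ v ∈ Z, x < v → v < x' → False := by
    intro v hv h1 h2
    rcases le_total v y with h3 | h3
    · exact absurd (le_csSup hbl ⟨hv, h3⟩) (not_le.2 h1)
    · exact absurd (csInf_le hbu ⟨hv, h3⟩) (not_le.2 h2)
  have hgap : ∀ i, ∀ v ∈ Z, F^[i] x < v → v < F^[i] x' → False := by
    intro i v hv h1 h2
    obtain ⟨u, rfl⟩ := h.bijective.2.iterate i v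
    have hmono := h.strictMono.iterate i
    exact hgap₀ u ((hZit u i).1 hv) (hmono.lt_iff_lt.1 h1) (hmono.lt_iff_lt.1 h2)
  have hdisj : ∀ u ∈ Ico x x', ∀ v ∈ Ico x x', ∀ i < q, ∀ k < q, ∀ m : ℤ, ∀ w,
      F^[i] u < w → w ≤ F^[i] v → F^[k] u + m < w → w ≤ F^[k] v + m → i = k ∧ m = 0 := by
    intro u hu v hv i hi k hk m w h1 h2 h3 h4
    have hm : ∀ i, F^[i] x ≤ F^[i] u ∧ F^[i] v < F^[i] x' := fun i ↦
      ⟨F.monotone.iterate i hu.1, h.strictMono.iterate i hv.2⟩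
    -- Two overlapping images of the gap have the same left end; otherwise one of these ends would
    -- be a point of `Z` inside the other image.
    have heq : F^[i] x = F^[k] x + m := by
      rcases lt_trichotomy (F^[i] x) (F^[k] x + m) with h5 | h5 | h5
      · exact (hgap i _ (hZint _ ((hZit x k).2 hx) m) h5 (by linarith [(hm i).2, (hm k).1])).elim
      · exact h5
      · refine (hgap k (F^[i] x + (-m : ℤ)) (hZint _ ((hZit x i).2 hx) _) ?_ ?_).elim
        · push_cast
          linarith
        · push_cast
          linarith [(hm k).2, (hm i).1]
    rcases lt_trichotomy i k with h5 | h5 | h5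
    · refine (CircleDeg1Lift.iterate_ne_iterate_add_int hpq hτ h5 hk x (-m) ?_).elim
      push_cast
      linarith
    · subst h5
      refine ⟨rfl, ?_⟩
      have : (m : ℝ) = 0 := by linarith
      exact_mod_cast this
    · exact (CircleDeg1Lift.iterate_ne_iterate_add_int hpq hτ h5 hi x m heq).elim
  have hK : ∀ u ∈ Ico x x', ∀ v ∈ Ico x x',
      |iterateExponent F a b q v - iterateExponent F a b q u| ≤ 2 := by
    intro u hu v hv
    rcases le_total u v with huv | huv
    · exact abs_iterateExponent_sub_le F.monotone huv (hdisj u hu v hv) a b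
    · rw [abs_sub_comm]
      exact abs_iterateExponent_sub_le F.monotone huv (hdisj v hv u hu) a b
  have hxZ : F^[q] x = x + p := hx
  have hxZ' : F^[q] x' = x' + p := hx'
  -- If some exponent is negative it is at most `-2`, so the variation bound makes all of them
  -- nonpositive.
  by_cases hs : ∀ w ∈ Ico x x', 0 ≤ iterateExponent F a b q w
  · have hC : ∀ w ∈ Ico x x', κ ^ iterateExponent F a b q w ≤ 1 := fun w hw ↦
      zpow_le_one₀ h.pos h.lt_one.le (hs w hw)
    have h1 := h.iterate_sub_le hxy fun w hw ↦ hC w ⟨hw.1, hw.2.trans_le hyx'⟩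
    have h2 := h.iterate_sub_le hyx' fun w hw ↦ hC w ⟨hxy.trans hw.1, hw.2⟩
    exact hy (by linarith)
  · push Not at hs
    obtain ⟨u, hu, hu0⟩ := hs
    have hC : ∀ w ∈ Ico x x', 1 ≤ κ ^ iterateExponent F a b q w := by
      intro w hw
      refine one_le_zpow_of_nonpos₀ h.pos h.lt_one.le ?_
      obtain ⟨s, hs⟩ := iterateExponent_even (F := F) (a := a) (b := b) hqe u
      have := (abs_le.1 (hK u hu w hw)).2
      omega
    have h1 := h.le_iterate_sub hxy fun w hw ↦ hC w ⟨hw.1, hw.2.trans_le hyx'⟩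
    have h2 := h.le_iterate_sub hyx' fun w hw ↦ hC w ⟨hxy.trans hw.1, hw.2⟩
    exact hy (by linarith)

end HasTwoSlopes

/-- A lift with an iterate equal to an integer translation is conjugate to a translation, by
averaging along orbits. -/
theorem CircleDeg1Lift.exists_conj_of_iterate_eq_add {F : CircleDeg1Lift}
    (hF : Function.Bijective F) {p : ℤ} {q : ℕ} (hq : 0 < q) (hit : ∀ x, F^[q] x = x + p) :
    ∃ H : CircleDeg1Lift, Function.Bijective H ∧ ∀ x, H (F x) = H x + p / q := by
  have hq' : (0 : ℝ) < q := by exact_mod_cast hq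
  have hcont : Continuous F := F.continuous_iff_surjective.2 hF.2
  have hmono : StrictMono F := F.strictMono_iff_injective.2 hF.1
  have hsm : StrictMono fun x ↦ (∑ i ∈ Finset.range q, F^[i] x) / q := by
    intro x y hxy
    refine div_lt_div_of_pos_right ?_ hq'
    exact Finset.sum_lt_sum_of_nonempty (Finset.nonempty_range_iff.2 hq.ne') fun i _ ↦
      hmono.iterate i hxy
  let H : CircleDeg1Lift := ⟨⟨fun x ↦ (∑ i ∈ Finset.range q, F^[i] x) / q, hsm.monotone⟩, fun x ↦ by
    have : ∀ i, F^[i] (x + 1) = F^[i] x + 1 := fun i ↦ by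
      simpa using F.iterate_add_int i x 1
    simp only [this, Finset.sum_add_distrib]
    simp [add_div, hq'.ne']⟩
  have hH : ∀ x, H x = (∑ i ∈ Finset.range q, F^[i] x) / q := fun _ ↦ rfl
  have hHc : Continuous H :=
    (continuous_finsetSum _ fun i _ ↦ hcont.iterate i).div_const _
  refine ⟨H, ⟨hsm.injective, H.continuous_iff_surjective.1 hHc⟩, fun x ↦ ?_⟩
  -- Splitting one sum of `q + 1` iterates at either end: replacing `x` by `F x` trades the term `x`
  -- for `F^[q] x = x + p`.
  have h1 := Finset.sum_range_succ (fun i ↦ F^[i] x) q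
  rw [Finset.sum_range_succ'] at h1
  simp only [Function.iterate_succ_apply, hit, Function.iterate_zero, id] at h1
  rw [hH, hH, ← add_div]
  congr 1
  linarith

/-! ### Irrational rotation number: Denjoy's theorem -/

/-- Take the least `q` that approximates within `ε`, which exists by Dirichlet: every smaller `k`
has error at least `ε`, hence larger than that of `q`. -/
theorem Irrational.exists_isLeast_approx {r : ℝ} (hr : Irrational r) {ε : ℝ} (hε : 0 < ε) :
    ∃ (q : ℕ) (p : ℤ), 0 < q ∧ q * r - p ≠ 0 ∧ |q * r - p| < ε ∧
      ∀ k : ℕ, 0 < k → k < q → ∀ m : ℤ, |q * r - p| < |k * r - m| := by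
  have hex : ∃ q : ℕ, 0 < q ∧ ∃ p : ℤ, |q * r - p| < ε := by
    obtain ⟨n, hn⟩ := exists_nat_one_div_lt hε
    obtain ⟨k, hk, -, hk'⟩ := Real.exists_nat_abs_mul_sub_round_le r n.succ_pos
    refine ⟨k, hk, round (k * r), hk'.trans_lt (lt_of_le_of_lt ?_ hn)⟩
    gcongr
    linarith
  classical
  obtain ⟨hq, p, hp⟩ := Nat.find_spec hex
  refine ⟨Nat.find hex, p, hq, ?_, hp, fun k hk hkq m ↦ ?_⟩
  · exact sub_ne_zero.2 ((hr.natCast_mul hq.ne').ne_int p)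
  · have := Nat.find_min hex hkq
    push Not at this
    exact hp.trans_le (this hk m)

namespace CircleDeg1Lift

variable {F H : CircleDeg1Lift} {r : ℝ}

theorem semiconj_iterate (hH : ∀ x, H (F x) = H x + r) (n : ℕ) (x : ℝ) :
    H (F^[n] x) = H x + n * r := by
  induction n generalizing x with
  | zero => simp
  | succ n ih =>
    rw [Function.iterate_succ_apply, ih, hH]
    push_cast
    ring

/-- A semiconjugacy to an irrational translation is continuous. -/
theorem continuous_of_semiconj (hF : Function.Surjective F) (hr : Irrational r)
    (hH : ∀ x, H (F x) = H x + r) : Continuous H := by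
  refine H.monotone.continuous_of_denseRange ?_
  -- The translations preserving the range of `H` form a group containing `r` and `1`, hence a dense
  -- one; so the range is dense, and a monotone map with dense range is continuous.
  let S : AddSubgroup ℝ :=
    { carrier := {t | ∀ v ∈ range H, v + t ∈ range H ∧ v - t ∈ range H}
      zero_mem' := fun v hv ↦ by simpa using hv
      add_mem' := fun {s t} hs ht v hv ↦ ⟨by
        rw [← add_assoc]; exact (ht _ (hs v hv).1).1, by
        rw [← sub_sub]; exact (ht _ (hs v hv).2).2⟩
      neg_mem' := fun {t} ht v hv ↦ ⟨by
        rw [← sub_eq_add_neg]; exact (ht v hv).2, by rw [sub_neg_eq_add]; exact (ht v hv).1⟩ }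
  have hS : AddSubgroup.closure {r, 1} ≤ S := by
    rw [AddSubgroup.closure_le]
    rintro t (rfl | rfl)
    · rintro _ ⟨x, rfl⟩
      obtain ⟨y, rfl⟩ := hF x
      exact ⟨⟨F (F y), hH _⟩, ⟨y, by rw [hH]; ring⟩⟩
    · rintro _ ⟨x, rfl⟩
      exact ⟨⟨x + 1, H.map_add_one x⟩, ⟨x - 1, by simpa using H.map_sub_int x 1⟩⟩
  have hd : Dense (AddSubgroup.closure {r, 1} : Set ℝ) :=
    dense_addSubgroupClosure_pair_iff.2 (by simpa using hr)
  have hd' := (Homeomorph.addLeft (H 0)).surjective.denseRange.dense_image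
    (Homeomorph.addLeft (H 0)).continuous hd
  refine hd'.mono ?_
  rintro _ ⟨t, ht, rfl⟩
  exact (hS ht _ ⟨0, rfl⟩).1

end CircleDeg1Lift

namespace HasTwoSlopes

variable {F H : CircleDeg1Lift} {κ a b r : ℝ}

/-- The Denjoy–Koksma inequality at a best approximation `q`. -/
theorem abs_iterateExponent_sub_le_of_semiconj (hH : ∀ x, H (F x) = H x + r) {q : ℕ} {δ : ℝ}
    (hδ : δ < 1) (hbest : ∀ k : ℕ, 0 < k → k < q → ∀ m : ℤ, δ < |k * r - m|) {y z : ℝ}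
    (hyz : |H z - H y| ≤ δ) :
    |iterateExponent F a b q z - iterateExponent F a b q y| ≤ 2 := by
  wlog hle : y ≤ z generalizing y z
  · rw [abs_sub_comm]
    exact this (by rwa [abs_sub_comm]) (le_of_not_ge hle)
  refine abs_iterateExponent_sub_le F.monotone hle ?_ a b
  intro i hi k hk m w h1 h2 h3 h4
  have g1 := H.monotone h1.le
  have g2 := H.monotone h2
  have g3 := H.monotone h3.le
  have g4 := H.monotone h4
  rw [H.map_add_int] at g3 g4
  rw [CircleDeg1Lift.semiconj_iterate hH] at g1 g2 g3 g4
  -- After applying `H`, an overlap means that two translates of `[H y, H z]`, by `i * r` and `k * r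
  -- + m`, meet; hence `|(i - k) * r - m| ≤ δ`.
  have hle' := (le_abs_self _).trans hyz
  rcases lt_trichotomy i k with h5 | h5 | h5
  · obtain ⟨d, rfl⟩ := Nat.exists_eq_add_of_lt h5
    have := hbest (d + 1) d.succ_pos (by omega) (-m)
    refine absurd this (not_lt.2 (abs_le.2 ?_))
    push_cast at g3 g4 ⊢
    constructor <;> linarith
  · subst h5
    refine ⟨rfl, ?_⟩
    have : |(m : ℝ)| < 1 := by
      rw [abs_lt]
      constructor <;> linarith
    exact Int.abs_lt_one_iff.1 (by exact_mod_cast this)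
  · obtain ⟨d, rfl⟩ := Nat.exists_eq_add_of_lt h5
    have := hbest (d + 1) d.succ_pos (by omega) m
    refine absurd this (not_lt.2 (abs_le.2 ?_))
    push_cast at g1 g2 ⊢
    constructor <;> linarith

/-- Denjoy's theorem: there are no wandering intervals. -/
theorem injective_of_semiconj (h : HasTwoSlopes F κ a b) (hr : Irrational r)
    (hH : ∀ x, H (F x) = H x + r) : Function.Injective H := by
  have hHc := CircleDeg1Lift.continuous_of_semiconj h.bijective.2 hr hH
  by_contra hinj
  obtain ⟨s₀, t₀, hst₀, hlt₀⟩ : ∃ s t, H s = H t ∧ s < t := by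
    simp only [Function.Injective] at hinj
    push Not at hinj
    obtain ⟨s, t, hst, hne⟩ := hinj
    rcases lt_or_gt_of_ne hne with h1 | h1
    · exact ⟨s, t, hst, h1⟩
    · exact ⟨t, s, hst.symm, h1⟩
  obtain ⟨s, t, hst, hfib⟩ : ∃ s t, s < t ∧ ∀ x, H x = H s₀ ↔ x ∈ Icc s t := by
    have hclosed : IsClosed (H ⁻¹' {H s₀}) := isClosed_singleton.preimage hHc
    have hbdd : H ⁻¹' {H s₀} ⊆ Icc (s₀ - 1) (s₀ + 1) := by
      intro x hx
      have hx : H x = H s₀ := hx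
      constructor
      · by_contra! h1
        have := H.monotone h1.le
        have h2 := H.map_sub_int s₀ 1
        push_cast at h2
        linarith
      · by_contra! h1
        have := H.monotone h1.le
        rw [H.map_add_one] at this
        linarith
    have hcpt := isCompact_Icc.of_isClosed_subset hclosed hbdd
    have hconn : IsConnected (H ⁻¹' {H s₀}) :=
      ⟨⟨s₀, rfl⟩, (ordConnected_singleton.preimage_mono H.monotone).isPreconnected⟩
    have heq := eq_Icc_of_connected_compact hconn hcpt
    have hmem : ∀ x, H x = H s₀ ↔ x ∈ Icc (sInf (H ⁻¹' {H s₀})) (sSup (H ⁻¹' {H s₀})) := by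
      intro x
      rw [← heq]
      rfl
    exact ⟨_, _, (((hmem s₀).1 rfl).1.trans_lt hlt₀).trans_le ((hmem t₀).1 hst₀.symm).2, hmem⟩
  set c := H s₀
  have hs : H s = c := (hfib s).2 ⟨le_rfl, hst.le⟩
  have ht : H t = c := (hfib t).2 ⟨hst.le, le_rfl⟩
  -- The factor `κ ^ 2` absorbs the distortion allowed by an exponent variation of 2; the factor `1
  -- / 2` makes the final inequalities incompatible.
  set η := κ ^ 2 * (t - s) / 2 with hη
  have hκ := h.pos
  have hηpos : 0 < η := by
    have : 0 < t - s := sub_pos.2 hst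
    positivity
  have hup : c < H (t + η) := by
    refine lt_of_le_of_ne (ht ▸ H.monotone (by linarith)) fun h1 ↦ ?_
    have := ((hfib _).1 h1.symm).2
    linarith
  have hdown : H (s - η) < c := by
    refine lt_of_le_of_ne (hs ▸ H.monotone (by linarith)) fun h1 ↦ ?_
    have := ((hfib _).1 h1).1
    linarith
  -- With this `ε`, the fibres of `H` over `c ± δ` lie within `η` of `[s, t]` without meeting it, so
  -- they have length at most `η`. They contain the image and the preimage of `[s, t]` under `F^q -
  -- p`.
  obtain ⟨q, p, hq, hne, hlt, hbest⟩ := hr.exists_isLeast_approx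
    (ε := min 1 (min (H (t + η) - c) (c - H (s - η))))
    (lt_min one_pos (lt_min (sub_pos.2 hup) (sub_pos.2 hdown)))
  set δ := (q : ℝ) * r - p with hδ
  rw [lt_min_iff, lt_min_iff] at hlt
  obtain ⟨hlt1, hlt2, hlt3⟩ := hlt
  have hshort : ∀ w w' d, H w = c + d → H w' = c + d → d ≠ 0 → |d| ≤ |δ| → w' - w ≤ η := by
    intro w w' d hw hw' hd hdδ
    have hmem : ∀ v, H v = c + d → s - η < v ∧ v < t + η := by
      intro v hv
      constructor
      · by_contra! h1
        have := H.monotone h1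
        linarith [neg_abs_le d]
      · by_contra! h1
        have := H.monotone h1
        linarith [le_abs_self d]
    rcases lt_or_gt_of_ne hd with h1 | h1
    · have : w' < s := by
        by_contra! h2
        linarith [H.monotone h2]
      linarith [(hmem w hw).1]
    · have : t < w := by
        by_contra! h2
        linarith [H.monotone h2]
      linarith [(hmem w' hw').2]
  obtain ⟨s', hs'⟩ := h.bijective.2.iterate q (s + p)
  obtain ⟨t', ht'⟩ := h.bijective.2.iterate q (t + p)
  have hHs' : H s' = c + -δ := by
    have := CircleDeg1Lift.semiconj_iterate hH q s'
    rw [hs', H.map_add_int, hs] at this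
    linarith
  have hHt' : H t' = c + -δ := by
    have := CircleDeg1Lift.semiconj_iterate hH q t'
    rw [ht', H.map_add_int, ht] at this
    linarith
  have hst' : s' ≤ t' := by
    refine ((h.strictMono.iterate q).lt_iff_lt.1 ?_).le
    rw [hs', ht']
    linarith
  have hJm : t' - s' ≤ η := hshort s' t' (-δ) hHs' hHt' (neg_ne_zero.2 hne) (abs_neg δ).le
  have hJp : F^[q] t - F^[q] s ≤ η := by
    have h1 := CircleDeg1Lift.semiconj_iterate hH q s
    have h2 := CircleDeg1Lift.semiconj_iterate hH q t
    have := hshort (F^[q] s + (-p : ℤ)) (F^[q] t + (-p : ℤ)) δ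
      (by rw [H.map_add_int, h1, hs, hδ]; push_cast; ring)
      (by rw [H.map_add_int, h2, ht, hδ]; push_cast; ring) hne le_rfl
    linarith
  have hexp : ∀ w, |H w - c| ≤ |δ| →
      |iterateExponent F a b q w - iterateExponent F a b q s| ≤ 2 := fun w hw ↦
    abs_iterateExponent_sub_le_of_semiconj hH hlt1 hbest (by rwa [hs])
  set e := iterateExponent F a b q s
  have h1 : κ ^ (e + 2) * (t - s) ≤ F^[q] t - F^[q] s := by
    refine h.le_iterate_sub hst.le fun w hw ↦
      zpow_le_zpow_right_of_le_one₀ hκ h.lt_one.le ?_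
    have := (abs_le.1 (hexp w (by simp [(hfib w).2 (Ico_subset_Icc_self hw)]))).2
    linarith
  have h2 : F^[q] t' - F^[q] s' ≤ κ ^ (e - 2) * (t' - s') := by
    refine h.iterate_sub_le hst' fun w hw ↦
      zpow_le_zpow_right_of_le_one₀ hκ h.lt_one.le ?_
    have hw1 := H.monotone hw.1
    have hw2 := H.monotone hw.2.le
    have := (abs_le.1 (hexp w (by
      rw [show H w = c + -δ by linarith]
      simp))).1
    linarith
  rw [hs', ht'] at h2
  have hK : 0 < κ ^ e := zpow_pos hκ e
  have hK2 : 0 < κ ^ 2 := by positivity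
  have e1 : κ ^ (e + 2) = κ ^ e * κ ^ 2 := by
    rw [zpow_add₀ hκ.ne']
    norm_cast
  have e2 : κ ^ (e - 2) * κ ^ 2 = κ ^ e := by
    have : κ ^ (2 : ℤ) = κ ^ 2 := by norm_cast
    rw [← this, ← zpow_add₀ hκ.ne']
    simp
  have hd : 0 < t - s := sub_pos.2 hst
  -- The short forward image forces a small slope on `[s, t]`; the short preimage forces a large
  -- one. The two slopes are comparable up to the distortion, which is contradictory.
  have h3 : κ ^ e ≤ 1 / 2 := by
    have : κ ^ e * (κ ^ 2 * (t - s)) ≤ 1 / 2 * (κ ^ 2 * (t - s)) := by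
      rw [e1] at h1
      linarith
    exact le_of_mul_le_mul_right this (by positivity)
  have h4 : 2 ≤ κ ^ e := by
    have h5 : t - s ≤ κ ^ (e - 2) * η :=
      (by linarith : t - s ≤ κ ^ (e - 2) * (t' - s')).trans
        (mul_le_mul_of_nonneg_left hJm (zpow_pos hκ _).le)
    have h6 : κ ^ (e - 2) * η = κ ^ e * (t - s) / 2 := by
      rw [hη, ← e2]
      ring
    have : 2 * (t - s) ≤ κ ^ e * (t - s) := by linarith
    exact le_of_mul_le_mul_right this hd
  linarith

/-- A two-slope lift whose rotation number is not a fraction with odd denominator is conjugate to a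
translation. -/
theorem exists_conj_translate (h : HasTwoSlopes F κ a b)
    (hr : F.translationNumber ∉ oddDenomRationals) :
    ∃ H : CircleDeg1Lift, Function.Bijective H ∧ ∀ x, H (F x) = H x + F.translationNumber := by
  by_cases hirr : Irrational F.translationNumber
  · obtain ⟨H, hH⟩ := CircleDeg1Lift.semiconj_of_bijective_of_translationNumber_eq h.bijective
      (CircleDeg1Lift.toOrderIso (CircleDeg1Lift.translate
        (Multiplicative.ofAdd F.translationNumber))).bijective
      (CircleDeg1Lift.translationNumber_translate _).symm
    have hH' : ∀ x, H (F x) = H x + F.translationNumber := fun x ↦ by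
      rw [hH x]
      simp [add_comm]
    exact ⟨H, ⟨h.injective_of_semiconj hirr hH', H.continuous_iff_surjective.1
      (CircleDeg1Lift.continuous_of_semiconj h.bijective.2 hirr hH')⟩, hH'⟩
  · rw [Irrational, not_not] at hirr
    obtain ⟨v, hv⟩ := hirr
    have hv' : F.translationNumber = v.num / v.den := by rw [← hv, ← Rat.cast_def]
    have hcop : IsCoprime v.num (v.den : ℤ) := by
      rw [Int.isCoprime_iff_gcd_eq_one]
      exact v.reduced
    have heven : Even v.den := by
      by_contra hodd
      exact hr ⟨v.num, v.den, v.pos, hcop, Nat.not_even_iff_odd.1 hodd, hv'⟩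
    rw [hv']
    exact CircleDeg1Lift.exists_conj_of_iterate_eq_add h.bijective v.pos
      (h.iterate_eq_add_of_even v.pos heven hcop hv')

end HasTwoSlopes

/-! ### Return maps of trapezoids have two-slope lifts -/

theorem UnitAddCircle.norm_coe_le_abs (x : ℝ) : ‖(x : UnitAddCircle)‖ ≤ |x| := by
  rw [UnitAddCircle.norm_eq]
  simpa using round_le x 0

theorem UnitAddCircle.coe_eq_coe_iff {x y : ℝ} :
    (x : UnitAddCircle) = y ↔ ∃ n : ℤ, x = y + n := by
  rw [← sub_eq_zero, ← AddCircle.coe_sub, AddCircle.coe_eq_zero_iff]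
  simp only [zsmul_eq_mul, mul_one, eq_sub_iff_add_eq']
  exact exists_congr fun n ↦ eq_comm

theorem UnitAddCircle.norm_coe_of_mem_left {x : ℝ} {k : ℤ} (h₁ : k ≤ x) (h₂ : x ≤ k + 1 / 2) :
    ‖(x : UnitAddCircle)‖ = x - k := by
  have h : (x : UnitAddCircle) = ((x - k : ℝ) : UnitAddCircle) :=
    UnitAddCircle.coe_eq_coe_iff.2 ⟨k, by ring⟩
  have habs : |x - k| = x - k := abs_of_nonneg (by linarith)
  rw [h, (AddCircle.norm_coe_eq_abs_iff (1 : ℝ) one_ne_zero).2, habs]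
  rw [habs, abs_one]
  linarith

theorem UnitAddCircle.norm_coe_of_mem_right {x : ℝ} {k : ℤ} (h₁ : k + 1 / 2 ≤ x) (h₂ : x ≤ k + 1) :
    ‖(x : UnitAddCircle)‖ = k + 1 - x := by
  have := UnitAddCircle.norm_coe_of_mem_left (x := -x) (k := -(k + 1))
    (by push_cast; linarith) (by push_cast; linarith)
  rw [AddCircle.coe_neg, norm_neg] at this
  rw [this]
  push_cast
  ring

theorem exists_eq_intCast_of_continuous {g : ℝ → ℝ} (hg : Continuous g)
    (h : ∀ x, ∃ n : ℤ, g x = n) : ∃ n : ℤ, ∀ x, g x = n := by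
  choose n hn using h
  have hc : Continuous n := by
    rw [Int.isClosedEmbedding_coe_real.isEmbedding.continuous_iff]
    exact hg.congr hn
  exact ⟨n 0, fun x ↦ by rw [hn x, PreconnectedSpace.constant inferInstance hc]⟩

section Trapezoid

variable {ℓ α θ : ℝ}

theorem roof_pos (hℓ : 0 < ℓ) (hα : 0 < α) (hα' : α < Real.pi / 2) (x : UnitAddCircle) :
    0 < roof ℓ α x := by
  have h1 := Real.tan_pos_of_pos_of_lt_pi_div_two hα hα'
  have h2 : ‖x‖ ≤ 1 / 2 := by simpa using AddCircle.norm_le_half_period (1 : ℝ) one_ne_zero (x := x)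
  have := mul_nonneg (sub_nonneg.2 h2) h1.le
  rw [roof]
  linarith

theorem abs_roof_sub_le (hα : 0 ≤ Real.tan α) (x y : ℝ) :
    |roof ℓ α x - roof ℓ α y| ≤ Real.tan α * |x - y| := by
  have h : roof ℓ α x - roof ℓ α y
      = Real.tan α * (‖(y : UnitAddCircle)‖ - ‖(x : UnitAddCircle)‖) := by
    simp only [roof]
    ring
  rw [h, abs_mul, abs_of_nonneg hα]
  refine mul_le_mul_of_nonneg_left ?_ hα
  rw [abs_sub_comm]
  refine (abs_norm_sub_norm_le _ _).trans ?_
  rw [← AddCircle.coe_sub]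
  exact UnitAddCircle.norm_coe_le_abs _

theorem continuous_roof (ℓ α : ℝ) : Continuous (roof ℓ α) := by
  unfold roof
  fun_prop

/-- The number is `tan α / tan θ`. Its being below 1 says that the flow is steeper than the roof. -/
theorem cot_mul_tan_mem (hα : 0 < α) (hαθ : α < θ) (hθ : θ < Real.pi / 2) :
    0 < Real.cos θ / Real.sin θ * Real.tan α ∧ Real.cos θ / Real.sin θ * Real.tan α < 1 := by
  have h1 := Real.tan_pos_of_pos_of_lt_pi_div_two hα (hαθ.trans hθ)
  have hs : 0 < Real.sin θ := Real.sin_pos_of_pos_of_lt_pi (by linarith) (by linarith)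
  have hc : 0 < Real.cos θ := Real.cos_pos_of_mem_Ioo ⟨by linarith, hθ⟩
  have h2 := Real.tan_lt_tan_of_nonneg_of_lt_pi_div_two hα.le hθ hαθ
  refine ⟨by positivity, ?_⟩
  rw [Real.tan_eq_sin_div_cos θ, lt_div_iff₀ hc] at h2
  rw [div_mul_eq_mul_div, div_lt_one hs]
  linarith

/-- Flowing back from the roof at abscissa `x` reaches the section at this point. The roof is `tan
α`-Lipschitz and `cot θ * tan α < 1`, so distinct collision abscissas have distinct starting points.
-/
theorem strictMono_sub_cot_mul_roof (ℓ : ℝ) (hα : 0 < α) (hαθ : α < θ) (hθ : θ < Real.pi / 2) :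
    StrictMono fun x : ℝ ↦ x - Real.cos θ / Real.sin θ * roof ℓ α x := by
  intro x y hxy
  obtain ⟨-, hlam⟩ := cot_mul_tan_mem hα hαθ hθ
  have hs : 0 < Real.sin θ := Real.sin_pos_of_pos_of_lt_pi (by linarith) (by linarith)
  have hc : 0 < Real.cos θ := Real.cos_pos_of_mem_Ioo ⟨by linarith, hθ⟩
  have h1 := (le_abs_self _).trans (abs_roof_sub_le (ℓ := ℓ)
    (Real.tan_pos_of_pos_of_lt_pi_div_two hα (hαθ.trans hθ)).le y x)
  rw [abs_of_pos (sub_pos.2 hxy)] at h1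
  have h2 := mul_le_mul_of_nonneg_left h1 (div_pos hc hs).le
  have h3 := mul_lt_mul_of_pos_right hlam (sub_pos.2 hxy)
  simp only
  linarith

theorem surjective_sub_cot_mul_roof (ℓ : ℝ) (α θ : ℝ) :
    Function.Surjective fun x : ℝ ↦ x - Real.cos θ / Real.sin θ * roof ℓ α x := by
  have hcont : Continuous fun x : ℝ ↦ Real.cos θ / Real.sin θ * roof ℓ α x :=
    ((continuous_roof ℓ α).comp (AddCircle.continuous_mk' 1)).const_mul _
  obtain ⟨C, hC⟩ := (isCompact_univ.image (((continuous_roof ℓ α).const_mul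
    (Real.cos θ / Real.sin θ)).abs)).bddAbove
  have hb : ∀ x : ℝ, |Real.cos θ / Real.sin θ * roof ℓ α x| ≤ C := fun x ↦
    hC (mem_image_of_mem _ (mem_univ (x : UnitAddCircle)))
  refine (continuous_id.sub hcont).surjective ?_ ?_
  · refine tendsto_atTop_mono (fun x ↦ ?_) (tendsto_atTop_add_const_right atTop (-C) tendsto_id)
    have := (abs_le.1 (hb x)).2
    simp only [Pi.sub_apply, id]
    linarith
  · refine tendsto_atBot_mono (fun x ↦ ?_) (tendsto_atBot_add_const_right atBot C tendsto_id)
    have := (abs_le.1 (hb x)).1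
    simp only [Pi.sub_apply, id]
    linarith

/-- In terms of the collision abscissa `x`, the return map sends `x - cot θ * roof x` to
`x + cot θ * roof x`. -/
theorem trapezoidReturnMap_coe (hℓ : 0 < ℓ) (hα : 0 < α) (hαθ : α < θ) (hθ : θ < Real.pi / 2)
    (x : ℝ) :
    trapezoidReturnMap ℓ α θ ((x - Real.cos θ / Real.sin θ * roof ℓ α x : ℝ) : UnitAddCircle)
      = ((x + Real.cos θ / Real.sin θ * roof ℓ α x : ℝ) : UnitAddCircle) := by
  have hs : 0 < Real.sin θ := Real.sin_pos_of_pos_of_lt_pi (by linarith) (by linarith)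
  have hc : 0 < Real.cos θ := Real.cos_pos_of_mem_Ioo ⟨by linarith, hθ⟩
  have htime : collisionTime ℓ α θ ((x - Real.cos θ / Real.sin θ * roof ℓ α x : ℝ) : UnitAddCircle)
      = roof ℓ α x / Real.sin θ := by
    -- The infimum runs over a single time: any collision abscissa `x'` has the same starting point
    -- as `x`, so injectivity gives `x' = x`.
    have hset : {s : ℝ | 0 < s ∧ s * Real.sin θ
        = roof ℓ α (((x - Real.cos θ / Real.sin θ * roof ℓ α x : ℝ) : UnitAddCircle)
          + ((s * Real.cos θ : ℝ) : UnitAddCircle))} = {roof ℓ α x / Real.sin θ} := by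
      ext s
      simp only [mem_ofPred_eq, mem_singleton_iff]
      rw [← AddCircle.coe_add]
      constructor
      · rintro ⟨-, hs'⟩
        set x' := x - Real.cos θ / Real.sin θ * roof ℓ α x + s * Real.cos θ with hx'
        have h1 : x' - Real.cos θ / Real.sin θ * roof ℓ α x'
            = x - Real.cos θ / Real.sin θ * roof ℓ α x := by
          rw [← hs', hx']
          field_simp
          ring
        have h2 : x' = x := (strictMono_sub_cot_mul_roof ℓ hα hαθ hθ).injective h1
        rw [h2] at hs'
        rw [← hs']
        field_simp
      · rintro rfl
        have h1 : x - Real.cos θ / Real.sin θ * roof ℓ α x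
            + roof ℓ α x / Real.sin θ * Real.cos θ = x := by
          field_simp
          ring
        rw [h1]
        refine ⟨div_pos (roof_pos hℓ hα (hαθ.trans hθ) _) hs, ?_⟩
        field_simp
    rw [collisionTime, hset, csInf_singleton]
  have hpoint : collisionPoint ℓ α θ
      ((x - Real.cos θ / Real.sin θ * roof ℓ α x : ℝ) : UnitAddCircle) = x := by
    rw [collisionPoint, htime, ← AddCircle.coe_add]
    congr 1
    field_simp
    ring
  rw [trapezoidReturnMap, hpoint, ← AddCircle.coe_add]
  congr 1
  field_simp

theorem hasDerivWithinAt_of_affine {F φ ψ : ℝ → ℝ} {x c u v N : ℝ} (hF : ∀ x, F (φ x) = ψ x + N)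
    (hxc : x < c) (hu : 0 < u) (hφ : ∀ y ∈ Ico x c, φ y = φ x + u * (y - x))
    (hψ : ∀ y ∈ Ico x c, ψ y = ψ x + v * (y - x)) :
    HasDerivWithinAt F (v / u) (Ici (φ x)) (φ x) := by
  have h1 : HasDerivWithinAt (fun y ↦ F (φ x) + v / u * (y - φ x)) (v / u) (Ici (φ x)) (φ x) := by
    simpa using ((((hasDerivAt_id (φ x)).sub_const (φ x)).const_mul (v / u)).const_add
      (F (φ x))).hasDerivWithinAt
  refine h1.congr_of_eventuallyEq ?_ (by simp)
  have h2 : φ x < φ x + u * (c - x) := by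
    have := mul_pos hu (sub_pos.2 hxc)
    linarith
  filter_upwards [Ico_mem_nhdsGE h2] with y hy
  have h3 : x + (y - φ x) / u ∈ Ico x c := by
    have h4 : 0 ≤ (y - φ x) / u := div_nonneg (sub_nonneg.2 hy.1) hu.le
    have h5 : (y - φ x) / u < c - x := by
      rw [div_lt_iff₀ hu]
      linarith [hy.2]
    constructor <;> linarith
  have h6 := hφ _ h3
  have h7 := hψ _ h3
  have h8 : φ (x + (y - φ x) / u) = y := by
    rw [h6]
    field_simp
    ring
  have h9 := hF (x + (y - φ x) / u)
  rw [h8, h7] at h9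
  rw [h9, hF]
  field_simp
  ring

/-- Where the roof descends, the starting point moves at rate `1 + lam` and the return point at rate
`1 - lam` in the collision abscissa; where it ascends, the rates are exchanged. -/
theorem IsTrapezoidReturnMap.hasTwoSlopes {f : UnitAddCircle → UnitAddCircle} {F : CircleDeg1Lift}
    (hf : IsTrapezoidReturnMap f) (hF : IsCircleLift F f) : ∃ κ a b, HasTwoSlopes F κ a b := by
  obtain ⟨ℓ, α, θ, hℓ, hα, hαθ, hθ, rfl⟩ := hf
  obtain ⟨hhomeo, hlift⟩ := hF
  obtain ⟨hlam, hlam1⟩ := cot_mul_tan_mem hα hαθ hθ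
  set μ := Real.cos θ / Real.sin θ with hμ
  set lam := μ * Real.tan α with hlam_def
  have hroofc : Continuous fun x : ℝ ↦ μ * roof ℓ α x :=
    ((continuous_roof ℓ α).comp (AddCircle.continuous_mk' 1)).const_mul _
  obtain ⟨N, hN⟩ := exists_eq_intCast_of_continuous
    (g := fun x ↦ F (x - μ * roof ℓ α x) - (x + μ * roof ℓ α x))
    ((hhomeo.continuous.comp (continuous_id.sub hroofc)).sub (continuous_id.add hroofc)) (by
      intro x
      have h1 := hlift (x - μ * roof ℓ α x)
      rw [trapezoidReturnMap_coe hℓ hα hαθ hθ, UnitAddCircle.coe_eq_coe_iff] at h1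
      obtain ⟨n, hn⟩ := h1
      exact ⟨n, by rw [hn]; ring⟩)
  have hN' : ∀ x : ℝ, F (x - μ * roof ℓ α x) = x + μ * roof ℓ α x + N := fun x ↦ by
    linarith [hN x]
  -- `a` and `b` are the starting points of the trajectories hitting the roof at its corners, of
  -- abscissas `0` and `1 / 2`.
  refine ⟨(1 - lam) / (1 + lam), -(μ * ℓ + lam / 2), 1 / 2 - μ * ℓ, hhomeo.bijective,
    div_pos (by linarith) (by linarith), (div_lt_one (by linarith)).2 (by linarith), fun y ↦ ?_⟩
  obtain ⟨x, rfl⟩ := surjective_sub_cot_mul_roof ℓ α θ y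
  simp only [← hμ]
  obtain ⟨k, hk, hk'⟩ : ∃ k : ℤ, k ≤ x ∧ x < k + 1 := ⟨⌊x⌋, Int.floor_le x, Int.lt_floor_add_one x⟩
  rcases lt_or_ge x (k + 1 / 2) with hx | hx
  · have hroof : ∀ y ∈ Ico x (k + 1 / 2 : ℝ), μ * roof ℓ α y = μ * ℓ + (1 / 2 - (y - k)) * lam := by
      intro y hy
      rw [roof, UnitAddCircle.norm_coe_of_mem_left (hk.trans hy.1) hy.2.le]
      ring
    have hx0 := hroof x ⟨le_rfl, hx⟩
    have hexp : slopeExponent (-(μ * ℓ + lam / 2)) (1 / 2 - μ * ℓ) (x - μ * roof ℓ α x) = 1 := by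
      have h1 : ⌊x - μ * roof ℓ α x - -(μ * ℓ + lam / 2)⌋ = k := by
        rw [Int.floor_eq_iff, hx0]
        constructor <;> nlinarith
      have h2 : ⌊x - μ * roof ℓ α x - (1 / 2 - μ * ℓ)⌋ = k - 1 := by
        rw [Int.floor_eq_iff, hx0]
        push_cast
        constructor <;> nlinarith
      rw [slopeExponent, h1, h2]
      ring
    rw [hexp, zpow_one]
    refine hasDerivWithinAt_of_affine (φ := fun x : ℝ ↦ x - μ * roof ℓ α x)
      (ψ := fun x : ℝ ↦ x + μ * roof ℓ α x) hN' hx (by linarith) ?_ ?_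
    · intro y hy
      simp only [hroof y hy, hx0]
      ring
    · intro y hy
      simp only [hroof y hy, hx0]
      ring
  · have hroof : ∀ y ∈ Ico x (k + 1 : ℝ), μ * roof ℓ α y = μ * ℓ + (y - k - 1 / 2) * lam := by
      intro y hy
      rw [roof, UnitAddCircle.norm_coe_of_mem_right (hx.trans hy.1) hy.2.le]
      ring
    have hx0 := hroof x ⟨le_rfl, hk'⟩
    have hexp : slopeExponent (-(μ * ℓ + lam / 2)) (1 / 2 - μ * ℓ) (x - μ * roof ℓ α x) = -1 := by
      have h1 : ⌊x - μ * roof ℓ α x - -(μ * ℓ + lam / 2)⌋ = k := by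
        rw [Int.floor_eq_iff, hx0]
        constructor <;> nlinarith
      have h2 : ⌊x - μ * roof ℓ α x - (1 / 2 - μ * ℓ)⌋ = k := by
        rw [Int.floor_eq_iff, hx0]
        constructor <;> nlinarith
      rw [slopeExponent, h1, h2]
      ring
    rw [hexp, zpow_neg_one, inv_div]
    refine hasDerivWithinAt_of_affine (φ := fun x : ℝ ↦ x - μ * roof ℓ α x)
      (ψ := fun x : ℝ ↦ x + μ * roof ℓ α x) hN' hk' (by linarith) ?_ ?_
    · intro y hy
      simp only [hroof y hy, hx0]
      ring
    · intro y hy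
      simp only [hroof y hy, hx0]
      ring

end Trapezoid

/-! ### Conjugacy on the circle, and its failure for odd denominators -/

theorem CircleDeg1Lift.exists_circle_homeomorph {H : CircleDeg1Lift} (hH : Function.Bijective H) :
    ∃ h : UnitAddCircle ≃ₜ UnitAddCircle, ∀ x : ℝ, h x = (H x : UnitAddCircle) := by
  have hper : Function.Periodic (fun x : ℝ ↦ (H x : UnitAddCircle)) 1 := fun x ↦ by
    simp
  have hcont : Continuous hper.lift :=
    continuous_quot_lift _ ((AddCircle.continuous_mk' 1).comp
      (H.continuous_iff_surjective.2 hH.2))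
  have hinj : Function.Injective hper.lift := by
    intro x y hxy
    induction x using QuotientAddGroup.induction_on with | H x => ?_
    induction y using QuotientAddGroup.induction_on with | H y => ?_
    obtain ⟨n, hn⟩ := UnitAddCircle.coe_eq_coe_iff.1 hxy
    rw [← H.map_add_int] at hn
    exact UnitAddCircle.coe_eq_coe_iff.2 ⟨n, hH.1 hn⟩
  have hsurj : Function.Surjective hper.lift := by
    intro y
    induction y using QuotientAddGroup.induction_on with | H y => ?_
    obtain ⟨x, rfl⟩ := hH.2 y
    exact ⟨x, rfl⟩
  exact ⟨Continuous.homeoOfEquivCompactToT2 (f := Equiv.ofBijective _ ⟨hinj, hsurj⟩) hcont,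
    fun _ ↦ rfl⟩

theorem IsCircleLift.isConjugateToRotation {f : UnitAddCircle → UnitAddCircle}
    {F H : CircleDeg1Lift} {r : ℝ} (hF : IsCircleLift F f) (hH : Function.Bijective H)
    (hFH : ∀ x, H (F x) = H x + r) : IsConjugateToRotation f r := by
  obtain ⟨h, hh⟩ := CircleDeg1Lift.exists_circle_homeomorph hH
  refine ⟨h, fun x ↦ ?_⟩
  induction x using QuotientAddGroup.induction_on with | H x => ?_
  rw [← hF.2, hh, hh, hFH, AddCircle.coe_add]

theorem IsCircleLift.iterate {f : UnitAddCircle → UnitAddCircle} {F : CircleDeg1Lift}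
    (hF : IsCircleLift F f) (n : ℕ) (x : ℝ) : ((F^[n] x : ℝ) : UnitAddCircle) = f^[n] x := by
  induction n with
  | zero => rfl
  | succ n ih => rw [Function.iterate_succ_apply', Function.iterate_succ_apply', hF.2, ih]

/-- A periodic point forces `q • s = 0`, so `f^q` is the identity and `F^q - id`, continuous and
integer-valued, is constant; for odd `q` this is impossible. -/
theorem HasTwoSlopes.not_isConjugateToRotation {f : UnitAddCircle → UnitAddCircle}
    {F : CircleDeg1Lift} {κ a b : ℝ} (h : HasTwoSlopes F κ a b) (hF : IsCircleLift F f)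
    (hr : F.translationNumber ∈ oddDenomRationals) (s : UnitAddCircle) :
    ¬ IsConjugateToRotation f s := by
  rintro ⟨g, hg⟩
  obtain ⟨p, q, hq, -, hodd, hpq⟩ := hr
  have hit : ∀ (n : ℕ) x, g (f^[n] x) = g x + n • s := by
    intro n x
    induction n with
    | zero => simp
    | succ n ih => rw [Function.iterate_succ_apply', hg, ih, succ_nsmul, add_assoc]
  obtain ⟨x₀, hx₀⟩ := (F.translationNumber_eq_rat_iff h.continuous hq).1 hpq
  rw [CircleDeg1Lift.coe_pow] at hx₀
  have hs : q • s = 0 := by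
    have h1 := hit q x₀
    rw [← hF.iterate, UnitAddCircle.coe_eq_coe_iff.2 ⟨p, hx₀⟩] at h1
    simpa using h1
  obtain ⟨N, hN⟩ := exists_eq_intCast_of_continuous (g := fun x ↦ F^[q] x - x)
    ((h.continuous.iterate q).sub continuous_id) (by
      intro x
      have h1 := hit q x
      rw [hs, add_zero, g.injective.eq_iff, ← hF.iterate, UnitAddCircle.coe_eq_coe_iff] at h1
      obtain ⟨n, hn⟩ := h1
      exact ⟨n, by rw [hn]; ring⟩)
  obtain ⟨x, hx⟩ := h.exists_iterate_ne_add hodd N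
  exact hx (by linarith [hN x])

/-- The translation number strictly increases at a lift conjugate to a translation. -/
theorem CircleDeg1Lift.translationNumber_lt_of_conj {F G H : CircleDeg1Lift}
    (hG : Function.Bijective G) (hH : Function.Bijective H)
    (hFH : ∀ x, H (F x) = H x + F.translationNumber) (hlt : ∀ x, F x < G x) :
    F.translationNumber < G.translationNumber := by
  obtain ⟨U, rfl⟩ := CircleDeg1Lift.isUnit_iff_bijective.2 hH
  rw [← CircleDeg1Lift.translationNumber_conj_eq U G]
  -- The conjugate of `G` lies strictly above the translation by the rotation number of `F`; its
  -- continuity turns this into a strict inequality of rotation numbers.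
  refine CircleDeg1Lift.lt_translationNumber_of_forall_add_lt _ ?_ fun y ↦ ?_
  · rw [CircleDeg1Lift.continuous_iff_surjective]
    exact (hH.2.comp hG.2).comp (CircleDeg1Lift.isUnit_iff_bijective.1 (U⁻¹).isUnit).2
  · obtain ⟨x, rfl⟩ := hH.2 y
    rw [← hFH]
    simp only [CircleDeg1Lift.mul_apply, CircleDeg1Lift.units_inv_apply_apply]
    exact (U : CircleDeg1Lift).strictMono_iff_injective.2 hH.1 (hlt x)

/-! ### Dependence of the rotation number on the parameter -/

namespace IsContinuousStrictlyIncreasingFamily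

variable {u₁ u₂ : ℝ} {f : ℝ → UnitAddCircle → UnitAddCircle} {F : ℝ → CircleDeg1Lift}

theorem continuousOn_iterate (hF : IsContinuousStrictlyIncreasingFamily u₁ u₂ f F) (n : ℕ)
    (x : ℝ) : ContinuousOn (fun u ↦ (F u)^[n] x) (Icc u₁ u₂) := by
  intro v hv
  induction n with
  | zero => exact continuousWithinAt_const
  | succ n ih =>
    simp only [Function.iterate_succ_apply', ContinuousWithinAt]
    exact (hF.continuous_supNorm v hv).tendsto_comp (hF.lift v hv).1.continuous.continuousAt ih

/-- The quotients `F^[n + 1] 0 / (n + 1)` differ from the rotation number by at most `1 / (n + 1)`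
whatever the lift, so the limit is uniform in `u`. -/
theorem continuousOn_translationNumber (hF : IsContinuousStrictlyIncreasingFamily u₁ u₂ f F) :
    ContinuousOn (fun u ↦ (F u).translationNumber) (Icc u₁ u₂) := by
  have hlim : TendstoUniformlyOn (fun (n : ℕ) u ↦ (F u)^[n + 1] 0 / (n + 1))
      (fun u ↦ (F u).translationNumber) atTop (Icc u₁ u₂) := by
    rw [Metric.tendstoUniformlyOn_iff]
    intro ε hε
    obtain ⟨N, hN⟩ := exists_nat_one_div_lt hε
    filter_upwards [eventually_ge_atTop N] with n hn u _
    have hpos : (0 : ℝ) < n + 1 := by positivity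
    have h1 := (F u).dist_pow_map_zero_mul_translationNumber_le (n + 1)
    rw [Real.dist_eq, CircleDeg1Lift.coe_pow] at h1
    have h2 : (F u).translationNumber - (F u)^[n + 1] 0 / (n + 1)
        = -(((F u)^[n + 1] 0 - ((n + 1 : ℕ) : ℝ) * (F u).translationNumber) / (n + 1)) := by
      push_cast
      field_simp
      ring
    rw [Real.dist_eq, h2, abs_neg, abs_div, abs_of_pos hpos]
    refine lt_of_le_of_lt ?_ hN
    gcongr
  exact hlim.continuousOn (Frequently.of_forall fun n ↦
    (hF.continuousOn_iterate (n + 1) 0).div_const _)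

theorem monotoneOn_translationNumber (hF : IsContinuousStrictlyIncreasingFamily u₁ u₂ f F) :
    MonotoneOn (fun u ↦ (F u).translationNumber) (Icc u₁ u₂) := fun _ hu _ hv huv ↦
  CircleDeg1Lift.translationNumber_mono fun x ↦ (hF.strictMono x).monotoneOn hu hv huv

theorem rotationFibre_nonempty (hF : IsContinuousStrictlyIncreasingFamily u₁ u₂ f F)
    (hu : u₁ ≤ u₂) {r : ℝ} (hr : r ∈ Icc (F u₁).translationNumber (F u₂).translationNumber) :
    (rotationFibre u₁ u₂ F r).Nonempty :=
  intermediate_value_Icc hu hF.continuousOn_translationNumber hr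

theorem exists_rotationFibre_eq_Icc (hF : IsContinuousStrictlyIncreasingFamily u₁ u₂ f F)
    (hu : u₁ ≤ u₂) {r : ℝ} (hr : r ∈ Icc (F u₁).translationNumber (F u₂).translationNumber) :
    ∃ c d, c ≤ d ∧ rotationFibre u₁ u₂ F r = Icc c d := by
  have hne := hF.rotationFibre_nonempty hu hr
  have hclosed : IsClosed (rotationFibre u₁ u₂ F r) :=
    hF.continuousOn_translationNumber.preimage_isClosed_of_isClosed isClosed_Icc
      isClosed_singleton
  have hcpt : IsCompact (rotationFibre u₁ u₂ F r) :=
    isCompact_Icc.of_isClosed_subset hclosed fun _ h ↦ h.1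
  have hord : (rotationFibre u₁ u₂ F r).OrdConnected := by
    refine ⟨fun v hv w hw x hx ↦ ?_⟩
    have hx' : x ∈ Icc u₁ u₂ := ⟨hv.1.1.trans hx.1, hx.2.trans hw.1.2⟩
    have h1 := hF.monotoneOn_translationNumber hv.1 hx' hx.1
    have h2 := hF.monotoneOn_translationNumber hx' hw.1 hx.2
    simp only [hv.2, hw.2] at h1 h2
    exact ⟨hx', le_antisymm h2 h1⟩
  have heq := eq_Icc_of_connected_compact ⟨hne, hord.isPreconnected⟩ hcpt
  refine ⟨_, _, ?_, heq⟩
  rw [heq] at hne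
  exact nonempty_Icc.1 hne

/-- If the fibre of an interior value `p / q` is a single point, then the `q`-th iterate there is an
integer translation. -/
theorem iterate_eq_add_of_rotationFibre_eq_singleton
    (hF : IsContinuousStrictlyIncreasingFamily u₁ u₂ f F) {p : ℤ} {q : ℕ} (hq : 0 < q) {c : ℝ}
    (hc : rotationFibre u₁ u₂ F (p / q) = {c}) (h₁ : (F u₁).translationNumber < p / q)
    (h₂ : p / q < (F u₂).translationNumber) (x : ℝ) : (F c)^[q] x = x + p := by
  have hq' : (0 : ℝ) < q := by exact_mod_cast hq
  obtain ⟨hcI, hcr⟩ : c ∈ rotationFibre u₁ u₂ F (p / q) := hc ▸ mem_singleton c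
  have hu₁c : u₁ < c := lt_of_le_of_ne hcI.1 fun h ↦ h₁.ne (h ▸ hcr)
  have hcu₂ : c < u₂ := lt_of_le_of_ne hcI.2 fun h ↦ h₂.ne (h ▸ hcr.symm)
  have hcont := hF.continuousOn_iterate q x c hcI
  have huniq : ∀ u ∈ Icc u₁ u₂, (F u).translationNumber = p / q → u = c := fun u hu hur ↦ by
    have : u ∈ rotationFibre u₁ u₂ F (p / q) := ⟨hu, hur⟩
    rwa [hc] at this
  -- A strict inequality at `c` survives for nearby parameters on the side where the rotation number
  -- could move away from `p / q`, and bounds it back to `p / q`; this gives a second point of the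
  -- fibre.
  rcases lt_trichotomy ((F c)^[q] x) (x + p) with hlt | heq | hgt
  · have h3 := (hcont.mono (Ioc_subset_Icc_self.trans (Icc_subset_Icc_left hu₁c.le) :
      Ioc c u₂ ⊆ Icc u₁ u₂)).eventually (gt_mem_nhds hlt)
    have : (𝓝[Ioc c u₂] c).NeBot := by
      rw [nhdsWithin_Ioc_eq_nhdsGT hcu₂]
      infer_instance
    obtain ⟨u, hux, hu⟩ := (h3.and self_mem_nhdsWithin).exists
    have huI : u ∈ Icc u₁ u₂ := ⟨(hu₁c.trans hu.1).le, hu.2⟩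
    rw [← CircleDeg1Lift.coe_pow] at hux
    have h4 := (F u ^ q).translationNumber_le_of_le_add_int hux.le
    rw [CircleDeg1Lift.translationNumber_pow, ← le_div_iff₀' hq'] at h4
    have h5 := hF.monotoneOn_translationNumber hcI huI hu.1.le
    simp only [hcr] at h5
    exact absurd (huniq u huI (le_antisymm h4 h5)) hu.1.ne'
  · exact heq
  · have h3 := (hcont.mono (Ico_subset_Icc_self.trans (Icc_subset_Icc_right hcu₂.le) :
      Ico u₁ c ⊆ Icc u₁ u₂)).eventually (lt_mem_nhds hgt)
    have : (𝓝[Ico u₁ c] c).NeBot := by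
      rw [nhdsWithin_Ico_eq_nhdsLT hu₁c]
      infer_instance
    obtain ⟨u, hux, hu⟩ := (h3.and self_mem_nhdsWithin).exists
    have huI : u ∈ Icc u₁ u₂ := ⟨hu.1, (hu.2.trans hcu₂).le⟩
    rw [← CircleDeg1Lift.coe_pow] at hux
    have h4 := (F u ^ q).le_translationNumber_of_add_int_le hux.le
    rw [CircleDeg1Lift.translationNumber_pow, ← div_le_iff₀' hq'] at h4
    have h5 := hF.monotoneOn_translationNumber huI hcI hu.2.le
    simp only [hcr] at h5
    exact absurd (huniq u huI (le_antisymm h5 h4)) hu.2.ne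

end IsContinuousStrictlyIncreasingFamily

theorem mainTheorem5 (u₁ u₂ : ℝ) (hu : u₁ < u₂)
    (f : ℝ → UnitAddCircle → UnitAddCircle) (F : ℝ → CircleDeg1Lift)
    (hf : ∀ u ∈ Set.Icc u₁ u₂, IsTrapezoidReturnMap (f u))
    (hF : IsContinuousStrictlyIncreasingFamily u₁ u₂ f F)
    (r : ℝ) (hr : r ∈ Set.Icc (F u₁).translationNumber (F u₂).translationNumber) :
    (r ∈ oddDenomRationals →
      (∃ c d : ℝ, c ≤ d ∧ rotationFibre u₁ u₂ F r = Set.Icc c d ∧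
        ((F u₁).translationNumber < r → r < (F u₂).translationNumber → c < d)) ∧
      ∀ u ∈ rotationFibre u₁ u₂ F r, ∀ s : UnitAddCircle, ¬ IsConjugateToRotation (f u) s) ∧
    (r ∉ oddDenomRationals →
      ∃ v : ℝ, rotationFibre u₁ u₂ F r = {v} ∧
        IsConjugateToRotation (f v) (r : UnitAddCircle)) := by
  have hslopes : ∀ u ∈ Icc u₁ u₂, ∃ κ a b, HasTwoSlopes (F u) κ a b := fun u hu ↦
    (hf u hu).hasTwoSlopes (hF.lift u hu)
  refine ⟨fun hodd ↦ ⟨?_, ?_⟩, fun hodd ↦ ?_⟩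
  · obtain ⟨c, d, hcd, hfib⟩ := hF.exists_rotationFibre_eq_Icc hu.le hr
    refine ⟨c, d, hcd, hfib, fun h₁ h₂ ↦ lt_of_le_of_ne hcd fun heq ↦ ?_⟩
    obtain ⟨p, q, hq, -, hqodd, rfl⟩ := hodd
    rw [← heq, Icc_self] at hfib
    have hc : c ∈ rotationFibre u₁ u₂ F (p / q) := hfib ▸ mem_singleton c
    obtain ⟨κ, a, b, h⟩ := hslopes c hc.1
    obtain ⟨x, hx⟩ := h.exists_iterate_ne_add hqodd p
    exact hx (hF.iterate_eq_add_of_rotationFibre_eq_singleton hq hfib h₁ h₂ x)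
  · rintro u ⟨huI, rfl⟩ s
    obtain ⟨κ, a, b, h⟩ := hslopes u huI
    exact h.not_isConjugateToRotation (hF.lift u huI) hodd s
  · obtain ⟨v, hvI, rfl⟩ := hF.rotationFibre_nonempty hu.le hr
    obtain ⟨κ, a, b, h⟩ := hslopes v hvI
    obtain ⟨H, hH, hFH⟩ := h.exists_conj_translate hodd
    refine ⟨v, ?_, (hF.lift v hvI).isConjugateToRotation hH hFH⟩
    refine eq_singleton_iff_unique_mem.2 ⟨⟨hvI, rfl⟩, ?_⟩
    rintro w ⟨hwI, hw⟩
    -- Strict increase needs the conjugacy at the smaller of the two parameters, so it is obtained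
    -- at `w` too.
    rcases lt_trichotomy w v with hlt | heq | hgt
    · obtain ⟨κ', a', b', h'⟩ := hslopes w hwI
      obtain ⟨H', hH', hFH'⟩ := h'.exists_conj_translate (hw ▸ hodd)
      exact absurd hw (CircleDeg1Lift.translationNumber_lt_of_conj (hF.lift v hvI).1.bijective
        hH' hFH' fun x ↦ hF.strictMono x hwI hvI hlt).ne
    · exact heq
    · exact absurd hw (CircleDeg1Lift.translationNumber_lt_of_conj (hF.lift w hwI).1.bijective
        hH hFH fun x ↦ hF.strictMono x hvI hwI hgt).ne'
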